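/- For $\tau$ in the upper half-plane $\mathbb{H}$ put $q=e^{2\pi i\tau}$, let $\eta(\tau)=e^{2\pi i\tau/24}\prod_{j=1}^{\infty}(1-q^{j})$ be the Dedekind eta function, and write $\eta_\ell=\eta(\ell\tau)$ for positive integers $\ell$. Define the level $20$ eta quotients $$u=\left(\frac{\eta_{1}\eta_{20}}{\eta_{4}\eta_{5}}\right)^{2},\qquad v=\left(\frac{\eta_{2}\eta_{5}\eta_{20}}{\eta_{1}\eta_{4}\eta_{10}}\right)^{2}.$$ Then, for every $\tau\in\mathbb{H}$, $$\frac{1}{u}+u=\frac{1}{v}+4+5v.$$ -/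

import Mathlib

/-- The rescaled Dedekind eta function `η_ℓ(τ) = η(ℓ τ)` on the upper half-plane, where
`η(τ) = q^(1/24) ∏_{j ≥ 1} (1 - q^j)` and `q = exp (2 π i τ)`. -/
noncomputable def etaScaled (l : ℕ) (τ : UpperHalfPlane) : ℂ :=
  ModularForm.eta ((l : ℂ) * (τ : ℂ))

/-- The eta quotient `u = (η_1 η_20 / (η_4 η_5))^2`. -/
noncomputable def uQuot (τ : UpperHalfPlane) : ℂ :=
  ((etaScaled 1 τ * etaScaled 20 τ) / (etaScaled 4 τ * etaScaled 5 τ)) ^ 2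

/-- The eta quotient `v = (η_2 η_5 η_20 / (η_1 η_4 η_10))^2`. -/
noncomputable def vQuot (τ : UpperHalfPlane) : ℂ :=
  ((etaScaled 2 τ * etaScaled 5 τ * etaScaled 20 τ) /
    (etaScaled 1 τ * etaScaled 4 τ * etaScaled 10 τ)) ^ 2

/-! Put X = (η_1 η_4 / η_2)^2 and Y = (η_5 η_20 / η_10)^2, so that v = Y / X. Adding 2 to both sides
makes them factor: 1/u + u + 2 is the square of ((η_4 η_5)^2 + (η_1 η_20)^2) / (η_1 η_4 η_5 η_20),
and 1/v + 6 + 5v = (X + Y)(X + 5Y) / (XY). Each of the three sums is a single eta quotient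
(`eta_identity_four_five`, `eta_identity_one_five`, `eta_identity_one_five_dual`), and both sides
become (η_2 η_10)^8 / (η_1 η_4 η_5 η_20)^4.

Write f(a, b) for `thetaSeries a b`, φ(q) = f(q, q) and 2ψ(q) = f(1, q). The first two sums come, at
-q, from ψ(q)² - q ψ(q⁵)² = f(q, q⁴) f(q², q³) and ψ(q²) φ(q⁵) - q φ(q) ψ(q¹⁰) = f(-q, -q²) f(-q⁵,
-q¹⁰). Both are proved by splitting a double sum over ℤ² into cosets of sublattices with a basis
orthogonal for the quadratic form in the exponent; the triple product `thetaSeries_eq_qProd` then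
turns theta series into Euler products. The formula for X + 5Y is the one for X + Y transformed by τ
↦ -1/(20τ). -/

open Filter Topology

/-! ### Infinite products. -/

/-- The infinite product `∏_{k ≥ 0} (1 + a p^k)`. -/
noncomputable def qProd (a p : ℂ) : ℂ := ∏' k : ℕ, (1 + a * p ^ k)

theorem summable_norm_mul_pow (a : ℂ) {p : ℂ} (hp : ‖p‖ < 1) :
    Summable fun k : ℕ => ‖a * p ^ k‖ := by
  simpa only [norm_mul, norm_pow] using
    (summable_geometric_of_lt_one (norm_nonneg p) hp).mul_left ‖a‖

theorem multipliable_qProd (a : ℂ) {p : ℂ} (hp : ‖p‖ < 1) :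
    Multipliable fun k : ℕ => 1 + a * p ^ k :=
  multipliable_one_add_of_summable (summable_norm_mul_pow a hp)

theorem tendsto_qProd (a : ℂ) {p : ℂ} (hp : ‖p‖ < 1) :
    Tendsto (fun n => ∏ k ∈ Finset.range n, (1 + a * p ^ k)) atTop (𝓝 (qProd a p)) :=
  (multipliable_qProd a hp).tendsto_prod_tprod_nat

theorem qProd_ne_zero {a p : ℂ} (ha : ‖a‖ < 1) (hp : ‖p‖ < 1) : qProd a p ≠ 0 := by
  refine tprod_one_add_ne_zero_of_summable (fun k h => ?_) (summable_norm_mul_pow a hp)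
  have h1 : ‖a * p ^ k‖ = 1 := by
    rw [← norm_neg, ← eq_neg_of_add_eq_zero_left h, norm_one]
  have h2 : ‖a * p ^ k‖ ≤ ‖a‖ := by
    rw [norm_mul, norm_pow]
    exact mul_le_of_le_one_right (norm_nonneg a) (pow_le_one₀ (norm_nonneg p) hp.le)
  linarith

theorem prod_range_mul_eq (f : ℕ → ℂ) (n N : ℕ) :
    ∏ k ∈ Finset.range (n * N), f k =
      ∏ r ∈ Finset.range n, ∏ j ∈ Finset.range N, f (n * j + r) := by
  rw [Finset.prod_comm]
  induction N with
  | zero => simp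
  | succ N ih => rw [Nat.mul_succ, Finset.prod_range_add, ih, Finset.prod_range_succ]

/-- Factors are grouped by exponent modulo `n`. Along partial products of length `n * N` this is a
finite regrouping, so no infinite rearrangement is needed. -/
theorem qProd_eq_prod_residues (a : ℂ) {p : ℂ} (hp : ‖p‖ < 1) {n : ℕ} (hn : 0 < n) :
    qProd a p = ∏ r ∈ Finset.range n, qProd (a * p ^ r) (p ^ n) := by
  have hpn : ‖p ^ n‖ < 1 := by
    rw [norm_pow]; exact pow_lt_one₀ (norm_nonneg p) hp hn.ne'
  have h1 := (tendsto_qProd a hp).comp (tendsto_id.const_mul_atTop' hn)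
  have h2 := tendsto_finsetProd (Finset.range n)
    fun r _ => tendsto_qProd (a * p ^ r) hpn
  refine tendsto_nhds_unique h1 (h2.congr fun N => ?_)
  simp only [Function.comp, id, prod_range_mul_eq]
  refine Finset.prod_congr rfl fun r _ => Finset.prod_congr rfl fun j _ => ?_
  rw [pow_add, pow_mul]; ring

theorem qProd_mul_qProd_neg (a : ℂ) {p : ℂ} (hp : ‖p‖ < 1) :
    qProd a p * qProd (-a) p = qProd (-a ^ 2) (p ^ 2) := by
  have hp2 : ‖p ^ 2‖ < 1 := by
    rw [norm_pow]; exact pow_lt_one₀ (norm_nonneg p) hp two_ne_zero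
  refine tendsto_nhds_unique ((tendsto_qProd a hp).mul (tendsto_qProd (-a) hp))
    ((tendsto_qProd (-a ^ 2) hp2).congr fun N => ?_)
  rw [← Finset.prod_mul_distrib]
  refine Finset.prod_congr rfl fun j _ => ?_
  ring

theorem qProd_eq_one_add_mul (a : ℂ) {p : ℂ} (hp : ‖p‖ < 1) :
    qProd a p = (1 + a) * qProd (a * p) p := by
  have h1 := (tendsto_qProd a hp).comp (tendsto_add_atTop_nat 1)
  refine tendsto_nhds_unique h1 (((tendsto_qProd (a * p) hp).const_mul (1 + a)).congr fun N => ?_)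
  simp only [Function.comp, Finset.prod_range_succ']
  rw [pow_zero, mul_one, mul_comm]
  congr 1
  refine Finset.prod_congr rfl fun j _ => ?_
  ring

/-! ### Gaussian binomials and the finite q-binomial theorem. -/

/-- Gaussian binomial coefficients evaluated at `p`. -/
def gaussBinom (p : ℂ) : ℕ → ℕ → ℂ
  | _, 0 => 1
  | 0, _ + 1 => 0
  | n + 1, m + 1 => gaussBinom p n m + p ^ (m + 1) * gaussBinom p n (m + 1)

theorem gaussBinom_zero_right (p : ℂ) (n : ℕ) : gaussBinom p n 0 = 1 := by
  cases n <;> rfl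

theorem gaussBinom_succ_succ (p : ℂ) (n m : ℕ) :
    gaussBinom p (n + 1) (m + 1) =
      gaussBinom p n m + p ^ (m + 1) * gaussBinom p n (m + 1) := rfl

theorem gaussBinom_eq_zero (p : ℂ) {n m : ℕ} (h : n < m) : gaussBinom p n m = 0 := by
  induction n generalizing m with
  | zero => obtain ⟨m, rfl⟩ := Nat.exists_eq_succ_of_ne_zero h.ne'; rfl
  | succ n ih =>
    obtain ⟨m, rfl⟩ := Nat.exists_eq_succ_of_ne_zero (Nat.ne_zero_of_lt h)
    rw [Nat.succ_eq_add_one, gaussBinom_succ_succ, ih (by omega), ih (by omega)]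
    simp

/-- The finite product `∏_{k < n} (1 - p^(k+1))`. -/
noncomputable def qFactorial (p : ℂ) (n : ℕ) : ℂ :=
  ∏ k ∈ Finset.range n, (1 + -p * p ^ k)

theorem qFactorial_succ (p : ℂ) (n : ℕ) :
    qFactorial p (n + 1) = qFactorial p n * (1 - p ^ (n + 1)) := by
  rw [qFactorial, Finset.prod_range_succ, ← qFactorial]; ring

theorem gaussBinom_mul_qFactorial (p : ℂ) (m l : ℕ) :
    gaussBinom p (m + l) m * (qFactorial p m * qFactorial p l) = qFactorial p (m + l) := by
  induction h : m + l generalizing m l with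
  | zero =>
    obtain ⟨rfl, rfl⟩ : m = 0 ∧ l = 0 := by omega
    simp [gaussBinom, qFactorial]
  | succ n ih =>
    rcases m with _ | m
    · obtain rfl : l = n + 1 := by omega
      simp [gaussBinom_zero_right, qFactorial]
    rw [gaussBinom_succ_succ]
    rcases l with _ | l
    · obtain rfl : n = m := by omega
      have := ih n 0 (by omega)
      rw [gaussBinom_eq_zero p (Nat.lt_succ_self n), qFactorial_succ]
      linear_combination (1 - p ^ (n + 1)) * this
    · have h1 := ih m (l + 1) (by omega)
      have h2 := ih (m + 1) l (by omega)
      have h3 : p ^ (n + 1) = p ^ (m + 1) * p ^ (l + 1) := by rw [← pow_add]; congr 1; omega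
      rw [qFactorial_succ p n, h3]
      rw [qFactorial_succ] at h1 h2 ⊢
      rw [qFactorial_succ p l]
      linear_combination (1 - p ^ (m + 1)) * h1 + p ^ (m + 1) * (1 - p ^ (l + 1)) * h2

/-- Induction with `x` general: removing the factor `k = 0` leaves the product at `x * p`, and
comparing coefficients gives the Pascal rule. -/
theorem prod_one_add_mul_pow_eq_sum (p : ℂ) (n : ℕ) (x : ℂ) :
    ∏ k ∈ Finset.range n, (1 + x * p ^ k) =
      ∑ m ∈ Finset.range (n + 1), gaussBinom p n m * p ^ m.choose 2 * x ^ m := by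
  induction n generalizing x with
  | zero => simp [gaussBinom]
  | succ n ih =>
    rw [Finset.prod_range_succ']
    have h : ∏ k ∈ Finset.range n, (1 + x * p ^ (k + 1)) =
        ∏ k ∈ Finset.range n, (1 + x * p * p ^ k) :=
      Finset.prod_congr rfl fun k _ => by ring
    rw [h, ih]
    conv_rhs => rw [Finset.sum_range_succ']
    have h2 : ∑ m ∈ Finset.range (n + 1), gaussBinom p n m * p ^ m.choose 2 * (x * p) ^ m =
        1 + ∑ m ∈ Finset.range (n + 1),
          gaussBinom p n (m + 1) * p ^ (m + 1).choose 2 * (x * p) ^ (m + 1) := by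
      rw [Finset.sum_range_succ', Finset.sum_range_succ _ n,
        gaussBinom_eq_zero p (Nat.lt_succ_self n), gaussBinom_zero_right]
      simp [add_comm]
    have h3 : ∀ m, (m + 1).choose 2 = m + m.choose 2 := fun m => by
      rw [Nat.choose_succ_succ' m 1, Nat.choose_one_right]
    calc _ = (∑ m ∈ Finset.range (n + 1), gaussBinom p n m * p ^ m.choose 2 * (x * p) ^ m)
          + x * ∑ m ∈ Finset.range (n + 1),
            gaussBinom p n m * p ^ m.choose 2 * (x * p) ^ m := by ring
      _ = _ := by
        nth_rewrite 1 [h2]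
        rw [Finset.mul_sum, add_assoc, ← Finset.sum_add_distrib, add_comm (1 : ℂ)]
        congr 1
        · refine Finset.sum_congr rfl fun m _ => ?_
          rw [gaussBinom_succ_succ, h3]
          ring
        · simp [gaussBinom_zero_right]

/-! ### Theta series and the Jacobi triple product. -/

/-- Triangular numbers indexed by the integers. -/
def tri (n : ℤ) : ℕ := (n * (n + 1) / 2).toNat

theorem two_mul_tri (n : ℤ) : 2 * (tri n : ℤ) = n * (n + 1) := by
  have h : 0 ≤ n * (n + 1) := by
    rcases le_or_gt 0 n with h | h <;> nlinarith
  have h2 : 2 ∣ n * (n + 1) := (Int.even_mul_succ_self n).two_dvd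
  rw [tri]
  omega

/-- Ramanujan's theta series `∑_n a^(n(n+1)/2) b^(n(n-1)/2)`. -/
noncomputable def thetaSeries (a b : ℂ) : ℂ := ∑' n : ℤ, a ^ tri n * b ^ tri (-n)

theorem summable_theta_nat {a b : ℂ} (hp : ‖a * b‖ < 1) :
    Summable fun n : ℕ => a ^ tri n * b ^ tri (-n) := by
  have hlim : Tendsto (fun n : ℕ => ‖a * (a * b) ^ n‖) atTop (𝓝 0) := by
    have := ((tendsto_pow_atTop_nhds_zero_of_norm_lt_one hp).const_mul a).norm
    simpa using this
  refine summable_of_ratio_norm_eventually_le (r := 1 / 2) (by norm_num) ?_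
  -- The ratio of consecutive terms is `a * (a * b) ^ n`, which tends to 0.
  filter_upwards [hlim.eventually_le_const (show (0 : ℝ) < 1 / 2 by norm_num)] with n hn
  have h1 : tri ((n + 1 : ℕ) : ℤ) = tri n + (n + 1) := by
    have := two_mul_tri ((n + 1 : ℕ) : ℤ)
    have := two_mul_tri n
    zify; push_cast at *; linarith
  have h2 : tri (-((n + 1 : ℕ) : ℤ)) = tri (-n) + n := by
    have := two_mul_tri (-((n + 1 : ℕ) : ℤ))
    have := two_mul_tri (-n)
    zify; push_cast at *; linarith
  rw [h1, h2, show a ^ (tri n + (n + 1)) * b ^ (tri (-n) + n) =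
    (a * (a * b) ^ n) * (a ^ tri n * b ^ tri (-n)) by ring, norm_mul]
  exact mul_le_mul_of_nonneg_right hn (norm_nonneg _)

theorem summable_theta {a b : ℂ} (hp : ‖a * b‖ < 1) :
    Summable fun n : ℤ => a ^ tri n * b ^ tri (-n) := by
  refine Summable.of_nat_of_neg (summable_theta_nat hp) ?_
  refine (summable_theta_nat (a := b) (b := a) (by rwa [mul_comm])).congr fun n => ?_
  rw [neg_neg, mul_comm]

theorem prod_mul_prod_eq_sum_gaussBinom {a b : ℂ} (ha : a ≠ 0) (hb : b ≠ 0) (N : ℕ) :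
    (∏ i ∈ Finset.range N, (1 + a * (a * b) ^ i)) * ∏ i ∈ Finset.range N, (1 + b * (a * b) ^ i) =
      ∑ m ∈ Finset.range (2 * N + 1),
        gaussBinom (a * b) (2 * N) m * (a ^ tri (m - N) * b ^ tri (-(m - N))) := by
  have hp : a * b ≠ 0 := mul_ne_zero ha hb
  set p := a * b with hpdef
  -- The choice `x = a / p ^ N` centres the product: the upper N factors are `1 + a * p ^ i`, and
  -- the lower N, read backwards, are `1 + b * p ^ i` up to monomials.
  have hbin := prod_one_add_mul_pow_eq_sum p (2 * N) (a / p ^ N)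
  rw [two_mul, Finset.prod_range_add] at hbin
  have h1 : ∏ i ∈ Finset.range N, (1 + a / p ^ N * p ^ (N + i)) =
      ∏ i ∈ Finset.range N, (1 + a * p ^ i) :=
    Finset.prod_congr rfl fun i _ => by rw [pow_add]; field_simp
  have h2 : (∏ i ∈ Finset.range N, (1 + a / p ^ N * p ^ i)) * p ^ tri N =
      a ^ N * ∏ i ∈ Finset.range N, (1 + b * p ^ i) := by
    rw [← Finset.prod_range_reflect]
    have h3 : p ^ tri N = ∏ i ∈ Finset.range N, p ^ (i + 1) := by
      rw [Finset.prod_pow_eq_pow_sum]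
      congr 1
      clear hbin h1
      induction N with
      | zero => rfl
      | succ N ih =>
        rw [Finset.sum_range_succ, ← ih]
        have := two_mul_tri ((N + 1 : ℕ) : ℤ)
        have := two_mul_tri N
        zify; push_cast at *; linarith
    have h5 : a ^ N = ∏ _i ∈ Finset.range N, a := by rw [Finset.prod_const, Finset.card_range]
    rw [h3, h5, ← Finset.prod_mul_distrib, ← Finset.prod_mul_distrib]
    refine Finset.prod_congr rfl fun i hi => ?_
    have hi' := Finset.mem_range.mp hi
    have h4 : p ^ N = p ^ (N - 1 - i) * p ^ (i + 1) := by rw [← pow_add]; congr 1; omega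
    rw [h4]
    field_simp
    rw [hpdef]
    ring
  rw [h1] at hbin
  have hpt : p ^ tri N ≠ 0 := pow_ne_zero _ hp
  have haN : a ^ N ≠ 0 := pow_ne_zero _ ha
  apply mul_left_cancel₀ haN
  rw [mul_left_comm, ← h2, mul_comm, mul_right_comm, hbin, Finset.sum_mul, ← two_mul,
    Finset.mul_sum]
  refine Finset.sum_congr rfl fun m _ => ?_
  rw [div_pow, ← pow_mul]
  have hpm : p ^ (N * m) ≠ 0 := pow_ne_zero _ hp
  have t1 := two_mul_tri N
  have t2 := two_mul_tri ((m : ℤ) - N)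
  have t3 := two_mul_tri (-((m : ℤ) - N))
  have t4 : 2 * (m.choose 2 : ℤ) = m * (m - 1) := by
    clear * -
    induction m with
    | zero => simp
    | succ m ih =>
      rw [Nat.choose_succ_succ' m 1, Nat.choose_one_right]
      push_cast; linarith
  have e1 : m.choose 2 + m + tri N = N + tri (m - N) + N * m := by
    zify; linarith
  have e2 : m.choose 2 + tri N = tri (-(m - N)) + N * m := by
    zify; linarith
  have key : p ^ m.choose 2 * a ^ m * p ^ tri N =
      a ^ N * (a ^ tri (m - N) * b ^ tri (-(m - N))) * p ^ (N * m) := by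
    calc _ = a ^ (m.choose 2 + m + tri N) * b ^ (m.choose 2 + tri N) := by rw [hpdef]; ring
      _ = _ := by rw [e1, e2, hpdef]; ring
  field_simp
  linear_combination (gaussBinom p (2 * N) m) * key

theorem tendsto_qFactorial {p : ℂ} (hp : ‖p‖ < 1) :
    Tendsto (qFactorial p) atTop (𝓝 (qProd (-p) p)) := tendsto_qProd (-p) hp

theorem qFactorial_ne_zero {p : ℂ} (hp : ‖p‖ < 1) (n : ℕ) : qFactorial p n ≠ 0 := by
  refine Finset.prod_ne_zero_iff.mpr fun k _ h => ?_
  have h1 : p ^ (k + 1) = 1 := by linear_combination -h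
  have h2 := congrArg norm h1
  rw [norm_pow, norm_one] at h2
  exact (pow_lt_one₀ (norm_nonneg p) hp k.succ_ne_zero).ne h2

/-- `qFactorial p` has a nonzero limit, so it and its inverse are bounded. The uniform bound gives
the domination in the triple product limit. -/
theorem exists_gaussBinom_bound {p : ℂ} (hp : ‖p‖ < 1) :
    ∃ C : ℝ, 0 ≤ C ∧ ∀ n m, ‖gaussBinom p n m‖ ≤ C := by
  have hne : qProd (-p) p ≠ 0 := qProd_ne_zero (by rwa [norm_neg]) hp
  obtain ⟨C₁, h₁⟩ := (tendsto_qFactorial hp).norm.bddAbove_range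
  obtain ⟨C₂, h₂⟩ := ((tendsto_qFactorial hp).inv₀ hne).norm.bddAbove_range
  simp only [mem_upperBounds, Set.forall_mem_range] at h₁ h₂
  have hC₁ : 0 ≤ C₁ := (norm_nonneg _).trans (h₁ 0)
  have hC₂ : 0 ≤ C₂ := (norm_nonneg _).trans (h₂ 0)
  refine ⟨C₁ * (C₂ * C₂), by positivity, fun n m => ?_⟩
  rcases lt_or_ge n m with h | h
  · rw [gaussBinom_eq_zero p h, norm_zero]; positivity
  · obtain ⟨l, rfl⟩ := Nat.exists_eq_add_of_le h
    have e : gaussBinom p (m + l) m =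
        qFactorial p (m + l) * ((qFactorial p m)⁻¹ * (qFactorial p l)⁻¹) := by
      rw [← gaussBinom_mul_qFactorial]
      field_simp [qFactorial_ne_zero hp]
    rw [e, norm_mul, norm_mul]
    gcongr
    exacts [h₁ _, h₂ _, h₂ _]

theorem tendsto_gaussBinom {p : ℂ} (hp : ‖p‖ < 1) (j : ℤ) :
    Tendsto (fun N : ℕ => gaussBinom p (2 * N) (N + j).toNat) atTop
      (𝓝 (qProd (-p) p)⁻¹) := by
  have hne : qProd (-p) p ≠ 0 := qProd_ne_zero (by rwa [norm_neg]) hp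
  have hq := tendsto_qFactorial hp
  have t0 : Tendsto (fun N : ℕ => 2 * N) atTop atTop := tendsto_id.const_mul_atTop' two_pos
  have t1 : Tendsto (fun N : ℕ => (N + j).toNat) atTop atTop :=
    tendsto_atTop.mpr fun b => by
      filter_upwards [eventually_ge_atTop (b + j.natAbs)] with N hN; omega
  have t2 : Tendsto (fun N : ℕ => (N - j).toNat) atTop atTop :=
    tendsto_atTop.mpr fun b => by
      filter_upwards [eventually_ge_atTop (b + j.natAbs)] with N hN; omega
  have hlim := (hq.comp t0).mul (((hq.comp t1).mul (hq.comp t2)).inv₀ (mul_ne_zero hne hne))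
  rw [show qProd (-p) p * (qProd (-p) p * qProd (-p) p)⁻¹ = (qProd (-p) p)⁻¹ by
    field_simp] at hlim
  refine hlim.congr' ?_
  filter_upwards [eventually_ge_atTop j.natAbs] with N hN
  simp only [Function.comp]
  have h := gaussBinom_mul_qFactorial p (N + j).toNat (N - j).toNat
  rw [show (N + j).toNat + (N - j).toNat = 2 * N by omega] at h
  rw [← h]
  field_simp [qFactorial_ne_zero hp]

/-- **Jacobi's triple product identity.** -/
theorem thetaSeries_eq_qProd {a b : ℂ} (ha : a ≠ 0) (hb : b ≠ 0) (hp : ‖a * b‖ < 1) :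
    thetaSeries a b = qProd a (a * b) * qProd b (a * b) * qProd (-(a * b)) (a * b) := by
  have hne : qProd (-(a * b)) (a * b) ≠ 0 := qProd_ne_zero (by rwa [norm_neg]) hp
  obtain ⟨C, hC, hbound⟩ := exists_gaussBinom_bound hp
  set t : ℤ → ℂ := fun n => a ^ tri n * b ^ tri (-n) with ht
  -- The cutoff is needed since for `j < -N` the truncation `toNat` would give coefficient 1; for `j
  -- > N` the coefficient vanishes by itself.
  set F : ℕ → ℤ → ℂ := fun N j =>
    if -(N : ℤ) ≤ j then gaussBinom (a * b) (2 * N) (N + j).toNat * t j else 0 with hF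
  have hsum : Summable fun j => C * ‖t j‖ := (summable_theta hp).norm.mul_left C
  have hlim := tendsto_tsum_of_dominated_convergence (𝓕 := atTop) (f := F)
    (g := fun j => (qProd (-(a * b)) (a * b))⁻¹ * t j) hsum
    (fun j => by
      refine ((tendsto_gaussBinom hp j).mul_const (t j)).congr' ?_
      filter_upwards [eventually_ge_atTop j.natAbs] with N hN
      rw [hF]
      exact (if_pos (by omega)).symm)
    (Eventually.of_forall fun N j => by
      rw [hF]
      dsimp only
      split_ifs
      · rw [norm_mul]
        exact mul_le_mul_of_nonneg_right (hbound _ _) (norm_nonneg _)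
      · rw [norm_zero]; positivity)
  have hfin : ∀ N, ∑' j, F N j = (∏ i ∈ Finset.range N, (1 + a * (a * b) ^ i)) *
      ∏ i ∈ Finset.range N, (1 + b * (a * b) ^ i) := by
    intro N
    rw [prod_mul_prod_eq_sum_gaussBinom ha hb,
      tsum_eq_sum (s := (Finset.range (2 * N + 1)).image fun m : ℕ => (m : ℤ) - N)]
    · rw [Finset.sum_image fun x _ y _ h => by simpa using h]
      refine Finset.sum_congr rfl fun m _ => ?_
      simp only [hF, ht]
      rw [if_pos (by omega), show ((N : ℤ) + (m - N)).toNat = m by omega]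
    · intro j hj
      simp only [hF]
      split_ifs with h
      · rw [gaussBinom_eq_zero, zero_mul]
        by_contra hlt
        refine hj (Finset.mem_image.mpr
          ⟨(N + j).toNat, Finset.mem_range.mpr (by omega), by omega⟩)
      · rfl
  simp only [hfin] at hlim
  have h := tendsto_nhds_unique hlim ((tendsto_qProd a hp).mul (tendsto_qProd b hp))
  rw [tsum_mul_left] at h
  change ∑' n, t n = _
  rw [← h]
  field_simp

/-! ### Theta functions as Euler products. -/

/-- The Euler product `∏_{n ≥ 1} (1 - q^n)`. -/
noncomputable def eulerProd (q : ℂ) : ℂ := qProd (-q) q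

theorem norm_pow_lt_one {q : ℂ} (hq : ‖q‖ < 1) {n : ℕ} (hn : n ≠ 0) : ‖q ^ n‖ < 1 := by
  rw [norm_pow]; exact pow_lt_one₀ (norm_nonneg q) hq hn

theorem eulerProd_ne_zero {q : ℂ} (hq : ‖q‖ < 1) : eulerProd q ≠ 0 :=
  qProd_ne_zero (by rwa [norm_neg]) hq

theorem qProd_self_mul_eulerProd {q : ℂ} (hq : ‖q‖ < 1) :
    qProd q q * eulerProd q = eulerProd (q ^ 2) := qProd_mul_qProd_neg q hq

theorem qProd_self_eq_mul {q : ℂ} (hq : ‖q‖ < 1) :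
    qProd q q = qProd q (q ^ 2) * qProd (q ^ 2) (q ^ 2) := by
  rw [qProd_eq_prod_residues q hq (n := 2) (by norm_num)]
  simp [Finset.prod_range_succ, pow_two]

theorem qProd_odd_mul {q : ℂ} (hq : ‖q‖ < 1) :
    qProd q (q ^ 2) * (eulerProd q * eulerProd (q ^ 4)) = eulerProd (q ^ 2) ^ 2 := by
  have h1 := qProd_self_mul_eulerProd hq
  have h2 := qProd_self_mul_eulerProd (norm_pow_lt_one hq two_ne_zero)
  rw [qProd_self_eq_mul hq] at h1
  rw [← pow_mul] at h2
  linear_combination eulerProd (q ^ 2) * h1 - qProd q (q ^ 2) * eulerProd q * h2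

theorem eulerProd_neg_mul {q : ℂ} (hq : ‖q‖ < 1) :
    eulerProd (-q) * (eulerProd q * eulerProd (q ^ 4)) = eulerProd (q ^ 2) ^ 3 := by
  have h : eulerProd (-q) = qProd q (q ^ 2) * eulerProd (q ^ 2) := by
    rw [eulerProd, qProd_eq_prod_residues (- -q) (by rwa [norm_neg]) (n := 2) (by norm_num)]
    simp [Finset.prod_range_succ, eulerProd, pow_two]
  rw [h]
  linear_combination eulerProd (q ^ 2) * qProd_odd_mul hq

/-- The series is 2ψ(q); the 2 is the factor `1 + a` of `qProd a q` at `a = 1`. -/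
theorem thetaSeries_one_mul {q : ℂ} (h0 : q ≠ 0) (hq : ‖q‖ < 1) :
    thetaSeries 1 q * eulerProd q = 2 * eulerProd (q ^ 2) ^ 2 := by
  have h := qProd_self_mul_eulerProd hq
  rw [thetaSeries_eq_qProd one_ne_zero h0 (by rwa [one_mul]), one_mul,
    qProd_eq_one_add_mul 1 hq, one_mul, ← eulerProd, ← h]
  ring

theorem thetaSeries_self_mul {q : ℂ} (h0 : q ≠ 0) (hq : ‖q‖ < 1) :
    thetaSeries q q * (eulerProd q * eulerProd (q ^ 4)) ^ 2 = eulerProd (q ^ 2) ^ 5 := by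
  have h := qProd_odd_mul hq
  have hq2 := norm_pow_lt_one hq two_ne_zero
  rw [thetaSeries_eq_qProd h0 h0 (by rwa [← pow_two]), ← pow_two q, ← eulerProd]
  calc _ = (qProd q (q ^ 2) * (eulerProd q * eulerProd (q ^ 4))) ^ 2 * eulerProd (q ^ 2) := by ring
    _ = _ := by rw [h]; ring

/-- The four `qProd` factors from the triple product are the nonzero residue classes mod 5 of `qProd
q q`. -/
theorem thetaSeries_mul_thetaSeries_five {q : ℂ} (h0 : q ≠ 0) (hq : ‖q‖ < 1) :
    thetaSeries q (q ^ 4) * thetaSeries (q ^ 2) (q ^ 3) * (eulerProd q * eulerProd (q ^ 10)) =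
      eulerProd (q ^ 2) * eulerProd (q ^ 5) ^ 3 := by
  have hq5 := norm_pow_lt_one hq (n := 5) (by norm_num)
  have h1 := qProd_self_mul_eulerProd hq
  have h2 := qProd_self_mul_eulerProd hq5
  rw [qProd_eq_prod_residues q hq (n := 5) (by norm_num)] at h1
  simp only [Finset.prod_range_succ, Finset.prod_range_zero, ← pow_succ',
    one_mul, Nat.reduceAdd, zero_add, pow_one] at h1
  rw [← pow_mul] at h2
  have e1 : q * q ^ 4 = q ^ 5 := by ring
  have e2 : q ^ 2 * q ^ 3 = q ^ 5 := by ring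
  rw [thetaSeries_eq_qProd h0 (pow_ne_zero 4 h0) (by rwa [e1]),
    thetaSeries_eq_qProd (pow_ne_zero 2 h0) (pow_ne_zero 3 h0) (by rwa [e2]), e1, e2, ← eulerProd]
  norm_num at h2
  rw [← h1, ← h2]
  ring

theorem thetaSeries_pentagonal {q : ℂ} (h0 : q ≠ 0) (hq : ‖q‖ < 1) :
    thetaSeries (-q) (-q ^ 2) = eulerProd q := by
  have h3 : -q * -q ^ 2 = q ^ 3 := by ring
  rw [thetaSeries_eq_qProd (neg_ne_zero.mpr h0) (neg_ne_zero.mpr (pow_ne_zero 2 h0))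
    (by rw [h3]; exact norm_pow_lt_one hq three_ne_zero), h3, eulerProd,
    qProd_eq_prod_residues (-q) hq (n := 3) (by norm_num)]
  simp only [Finset.prod_range_succ, Finset.prod_range_zero, one_mul,
    neg_mul, ← pow_succ', Nat.reduceAdd, zero_add, pow_one]

/-! ### Theta series with quadratic exponents. -/

/-- The series `∑_n ε^n x^(α n² + β n)` over the integers. -/
noncomputable def quadSeries (ε x : ℂ) (α β : ℤ) : ℂ :=
  ∑' n : ℤ, ε ^ n * x ^ (α * n ^ 2 + β * n)

section quadSeries

variable {ε x : ℂ} (hε : ε ^ 2 = 1) (h0 : x ≠ 0)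

include hε h0 in
theorem theta_term_eq_quad (α β n : ℤ) :
    (ε * x ^ (α + β)) ^ tri n * (ε * x ^ (α - β)) ^ tri (-n) =
      ε ^ n * x ^ (α * n ^ 2 + β * n) := by
  have hε0 : ε ≠ 0 := fun h => by simp [h] at hε
  have t1 := two_mul_tri n
  have t2 := two_mul_tri (-n)
  have e1 : ε ^ tri n * ε ^ tri (-n) = ε ^ n := by
    rw [← zpow_natCast, ← zpow_natCast, ← zpow_add₀ hε0]
    -- `tri n + tri (-n)` is n², which has the parity of n, and ε² = 1.
    obtain ⟨c, hc⟩ := (Int.even_mul_succ_self (n - 1)).two_dvd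
    rw [show (tri n + tri (-n) : ℤ) = 2 * c + n by linarith, zpow_add₀ hε0, zpow_mul,
      zpow_ofNat, hε, one_zpow, one_mul]
  rw [mul_pow, mul_pow, ← e1, mul_mul_mul_comm]
  congr 1
  rw [← zpow_natCast (x ^ (α + β)), ← zpow_natCast (x ^ (α - β)), ← zpow_mul, ← zpow_mul,
    ← zpow_add₀ h0]
  congr 1
  linarith [congrArg (fun z => (α + β) * z) t1, congrArg (fun z => (α - β) * z) t2]

include hε h0 in
theorem thetaSeries_eq_quadSeries (α β : ℤ) :
    thetaSeries (ε * x ^ (α + β)) (ε * x ^ (α - β)) = quadSeries ε x α β :=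
  tsum_congr (theta_term_eq_quad hε h0 α β)

include hε h0 in
theorem summable_quad (hx : ‖x‖ < 1) {α : ℤ} (hα : 0 < α) (β : ℤ) :
    Summable fun n : ℤ => ε ^ n * x ^ (α * n ^ 2 + β * n) := by
  refine (summable_theta ?_).congr (theta_term_eq_quad hε h0 α β)
  obtain ⟨k, rfl⟩ := Int.eq_ofNat_of_zero_le hα.le
  have h : ε * x ^ ((k : ℤ) + β) * (ε * x ^ ((k : ℤ) - β)) = x ^ (2 * k) := by
    rw [mul_mul_mul_comm, ← zpow_add₀ h0, ← pow_two, hε, one_mul, ← zpow_natCast]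
    congr 1; push_cast; ring
  rw [h]
  exact norm_pow_lt_one hx (by omega)

include hε in
theorem quadSeries_neg (α β : ℤ) : quadSeries ε x α (-β) = quadSeries ε x α β := by
  rw [quadSeries, ← (Equiv.neg ℤ).tsum_eq]
  refine tsum_congr fun n => ?_
  have hε' : ε⁻¹ = ε := inv_eq_of_mul_eq_one_left (by rw [← pow_two, hε])
  rw [Equiv.neg_apply, zpow_neg, ← inv_zpow, hε']
  congr 2
  ring

include hε h0 in
theorem quadSeries_shift (α β : ℤ) :
    quadSeries ε x α β = ε * x ^ (α + β) * quadSeries ε x α (β + 2 * α) := by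
  have hε0 : ε ≠ 0 := fun h => by simp [h] at hε
  rw [quadSeries, ← (Equiv.addRight (1 : ℤ)).tsum_eq, quadSeries, ← tsum_mul_left]
  refine tsum_congr fun n => ?_
  rw [Equiv.coe_addRight, zpow_add_one₀ hε0,
    show α * (n + 1) ^ 2 + β * (n + 1) = (α + β) + (α * n ^ 2 + (β + 2 * α) * n) by ring,
    zpow_add₀ h0 (α + β)]
  ring

include hε h0 in
theorem hasSum_quad_mul (hx : ‖x‖ < 1) {α γ : ℤ} (hα : 0 < α) (hγ : 0 < γ) (β δ : ℤ) :
    HasSum (fun p : ℤ × ℤ => (ε ^ p.1 * x ^ (α * p.1 ^ 2 + β * p.1)) *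
        (ε ^ p.2 * x ^ (γ * p.2 ^ 2 + δ * p.2)))
      (quadSeries ε x α β * quadSeries ε x γ δ) := by
  have h1 := (summable_quad hε h0 hx hα β).norm
  have h2 := (summable_quad hε h0 hx hγ δ).norm
  rw [quadSeries, quadSeries, tsum_mul_tsum_of_summable_norm h1 h2]
  exact (summable_mul_of_summable_norm h1 h2).hasSum

end quadSeries

/-! ### Double sums split over cosets of sublattices. -/

theorem hasSum_of_fin_partition {k : ℕ} {γ δ : Type*} (e : Fin k × γ ≃ δ) {F : δ → ℂ}
    {a : Fin k → ℂ} (h : ∀ r, HasSum (fun z => F (e (r, z))) (a r)) :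
    HasSum F (∑ r, a r) := by
  classical
  rw [← e.hasSum_iff]
  have h1 : ∀ r, HasSum (fun w : Fin k × γ => if w.1 = r then F (e w) else 0) (a r) := by
    intro r
    rw [← (Prod.mk_right_injective r).hasSum_iff]
    · simpa [Function.comp_def] using h r
    · rintro ⟨s, z⟩ hz
      refine if_neg fun hs : s = r => hz ⟨z, by rw [hs]⟩
  have h2 := hasSum_sum (s := Finset.univ) fun r _ => h1 r
  simpa [Function.comp_def] using h2

/-- The five cosets of the sublattice of `ℤ²` generated by `(2, -1)` and `(1, 2)`. -/
def cosetEquivFive : Fin 5 × (ℤ × ℤ) ≃ ℤ × ℤ where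
  toFun w := (2 * w.2.1 + w.2.2 + (w.1 : ℕ), 2 * w.2.2 - w.2.1)
  invFun p := (⟨((p.1 + 2 * p.2) % 5).toNat, by omega⟩,
    ((2 * (p.1 - (p.1 + 2 * p.2) % 5) - p.2) / 5, (p.1 - (p.1 + 2 * p.2) % 5 + 2 * p.2) / 5))
  left_inv := by
    rintro ⟨⟨r, hr⟩, m, n⟩
    simp only [Prod.mk.injEq, Fin.mk.injEq]
    refine ⟨?_, ?_, ?_⟩ <;> omega
  right_inv := by
    rintro ⟨m, n⟩
    simp only [Prod.mk.injEq]
    refine ⟨?_, ?_⟩ <;> omega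

/-- The two cosets of the sublattice of `ℤ²` generated by `(1, 0)` and `(1, 2)`. -/
def cosetEquivTwo : Fin 2 × (ℤ × ℤ) ≃ ℤ × ℤ where
  toFun w := (w.2.1 + w.2.2, 2 * w.2.2 + (w.1 : ℕ))
  invFun p := (⟨(p.2 % 2).toNat, by omega⟩, (p.1 - p.2 / 2, p.2 / 2))
  left_inv := by
    rintro ⟨⟨r, hr⟩, m, n⟩
    simp only [Prod.mk.injEq, Fin.mk.injEq]
    refine ⟨?_, ?_, ?_⟩ <;> omega
  right_inv := by
    rintro ⟨m, n⟩
    simp only [Prod.mk.injEq]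
    refine ⟨?_, ?_⟩ <;> omega

/-- The three cosets of the sublattice of `ℤ²` generated by `(0, -1)` and `(3, 1)`. -/
def cosetEquivThree : Fin 3 × (ℤ × ℤ) ≃ ℤ × ℤ where
  toFun w := (3 * w.2.2 + (w.1 : ℕ), w.2.2 - w.2.1)
  invFun p := (⟨(p.1 % 3).toNat, by omega⟩, (p.1 / 3 - p.2, p.1 / 3))
  left_inv := by
    rintro ⟨⟨r, hr⟩, m, n⟩
    simp only [Prod.mk.injEq, Fin.mk.injEq]
    refine ⟨?_, ?_, ?_⟩ <;> omega
  right_inv := by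
    rintro ⟨m, n⟩
    simp only [Prod.mk.injEq]
    refine ⟨?_, ?_⟩ <;> omega

/-- (2, -1) and (1, 2) are orthogonal of norm 5 for m² + n². The coset r = 1 gives the square on the
right; the other four agree after shifts and reflections. -/
theorem quadSeries_sq_dissection {x : ℂ} (h0 : x ≠ 0) (hx : ‖x‖ < 1) :
    quadSeries 1 x 1 1 ^ 2 =
      x ^ 2 * quadSeries 1 x 5 5 ^ 2 + 4 * (quadSeries 1 x 5 1 * quadSeries 1 x 5 3) := by
  have hε : (1 : ℂ) ^ 2 = 1 := one_pow 2
  have h1 := hasSum_quad_mul hε h0 hx one_pos one_pos 1 1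
  have h2 := hasSum_of_fin_partition cosetEquivFive
    (a := fun r => x ^ (((r : ℕ) : ℤ) ^ 2 + (r : ℕ)) *
      (quadSeries 1 x 5 (4 * (r : ℕ) + 1) * quadSeries 1 x 5 (2 * (r : ℕ) + 3)))
    (F := fun p => (1 ^ p.1 * x ^ (1 * p.1 ^ 2 + 1 * p.1)) *
        (1 ^ p.2 * x ^ (1 * p.2 ^ 2 + 1 * p.2))) fun r => by
      refine ((hasSum_quad_mul hε h0 hx (α := 5) (γ := 5) (by norm_num) (by norm_num)
        (4 * (r : ℕ) + 1) (2 * (r : ℕ) + 3)).mul_left _).congr_fun fun p => ?_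
      simp only [cosetEquivFive, Equiv.coe_fn_mk, one_zpow, one_mul, ← zpow_add₀ h0]
      congr 1
      ring
  have h := h1.unique h2
  have s1 := quadSeries_shift hε h0 5 (-1)
  have s2 := quadSeries_shift hε h0 5 (-3)
  have s3 := quadSeries_shift hε h0 5 3
  have s4 := quadSeries_shift hε h0 5 7
  have s5 := quadSeries_shift hε h0 5 1
  rw [quadSeries_neg hε] at s1 s2
  simp only [Fin.sum_univ_five, Fin.val_zero, Fin.val_one, Fin.val_two] at h
  norm_num [zpow_ofNat] at h s1 s2 s3 s4 s5
  have t1 : x ^ 6 * (quadSeries 1 x 5 9 * quadSeries 1 x 5 7) =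
      quadSeries 1 x 5 1 * quadSeries 1 x 5 3 := by
    linear_combination -quadSeries 1 x 5 3 * s1 - x ^ 4 * quadSeries 1 x 5 9 * s2
  have t2 : x ^ 12 * (quadSeries 1 x 5 13 * quadSeries 1 x 5 9) =
      quadSeries 1 x 5 1 * quadSeries 1 x 5 3 := by
    linear_combination -quadSeries 1 x 5 3 * s1 - x ^ 4 * quadSeries 1 x 5 9 * s3
  have t3 : x ^ 20 * (quadSeries 1 x 5 17 * quadSeries 1 x 5 11) =
      quadSeries 1 x 5 1 * quadSeries 1 x 5 3 := by
    linear_combination -quadSeries 1 x 5 3 * s5 -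
      x ^ 6 * quadSeries 1 x 5 11 * s2 - x ^ 8 * quadSeries 1 x 5 11 * s4
  linear_combination h + t1 + t2 + t3

/-- One signed double sum is split twice. The form 2m² - 2mn + 3n² is diagonal with values 2, 10 on
the basis (1, 0), (1, 2), and with values 3, 15 on (0, -1), (3, 1). -/
theorem quadSeries_pentagonal_product {x : ℂ} (h0 : x ≠ 0) (hx : ‖x‖ < 1) :
    quadSeries 1 x 2 2 * quadSeries 1 x 10 0 - x ^ 2 * (quadSeries 1 x 2 0 * quadSeries 1 x 10 10) =
      2 * (quadSeries (-1) x 3 1 * quadSeries (-1) x 15 5) := by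
  have hε : (1 : ℂ) ^ 2 = 1 := one_pow 2
  have hε' : (-1 : ℂ) ^ 2 = 1 := by norm_num
  have hm : (-1 : ℂ) ≠ 0 := by norm_num
  have h1 := hasSum_of_fin_partition cosetEquivTwo
    (a := fun r => (-1) ^ (r : ℕ) * x ^ (2 * (r : ℕ)) *
      (quadSeries 1 x 2 (2 - 2 * (r : ℕ)) * quadSeries 1 x 10 (10 * (r : ℕ))))
    (F := fun p => (-1) ^ p.2 * x ^ (2 * p.1 ^ 2 + 2 * p.1 - 2 * p.1 * p.2 - p.2 + 3 * p.2 ^ 2))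
    fun r => by
      refine ((hasSum_quad_mul hε h0 hx (α := 2) (γ := 10) (by norm_num) (by norm_num)
        (2 - 2 * (r : ℕ)) (10 * (r : ℕ))).mul_left _).congr_fun fun p => ?_
      simp only [cosetEquivTwo, Equiv.coe_fn_mk, one_zpow, one_mul, zpow_add₀ hm, zpow_mul,
        zpow_ofNat, hε', zpow_natCast]
      rw [mul_assoc ((-1 : ℂ) ^ (r : ℕ))]
      congr 1
      rw [← zpow_natCast x, ← zpow_add₀ h0, ← zpow_add₀ h0]
      congr 1
      have hr : ((r : ℕ) : ℤ) ^ 2 = (r : ℕ) := by fin_cases r <;> norm_num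
      push_cast
      linear_combination 3 * hr
  have h2 := hasSum_of_fin_partition cosetEquivThree
    (a := fun r => x ^ (2 * ((r : ℕ) : ℤ) ^ 2 + 2 * (r : ℕ)) *
      (quadSeries (-1) x 3 (2 * (r : ℕ) + 1) * quadSeries (-1) x 15 (10 * (r : ℕ) + 5)))
    (F := fun p => (-1) ^ p.2 * x ^ (2 * p.1 ^ 2 + 2 * p.1 - 2 * p.1 * p.2 - p.2 + 3 * p.2 ^ 2))
    fun r => by
      refine ((hasSum_quad_mul hε' h0 hx (α := 3) (γ := 15) (by norm_num) (by norm_num)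
        (2 * (r : ℕ) + 1) (10 * (r : ℕ) + 5)).mul_left _).congr_fun fun p => ?_
      have hs : (-1 : ℂ) ^ (p.2 - p.1) = (-1) ^ p.1 * (-1) ^ p.2 := by
        rw [zpow_sub₀ hm, div_eq_mul_inv, ← inv_zpow, inv_neg_one, mul_comm]
      simp only [cosetEquivThree, Equiv.coe_fn_mk, hs]
      rw [mul_mul_mul_comm, mul_left_comm, ← zpow_add₀ h0, ← zpow_add₀ h0]
      congr 2
      ring
  have h := h1.unique h2
  have s1 := quadSeries_shift hε' h0 3 (-1)
  have s2 := quadSeries_shift hε' h0 15 (-5)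
  have s3 := quadSeries_shift hε' h0 3 (-3)
  rw [quadSeries_neg hε'] at s1 s2 s3
  simp only [Fin.sum_univ_two, Fin.sum_univ_three, Fin.val_zero, Fin.val_one, Fin.val_two] at h
  norm_num [zpow_ofNat] at h s1 s2 s3
  -- The middle coset vanishes: n ↦ -1 - n fixes the exponent and flips the sign.
  have z : quadSeries (-1) x 3 3 = 0 := by linear_combination s3 / 2
  have t : x ^ 12 * (quadSeries (-1) x 3 5 * quadSeries (-1) x 15 25) =
      quadSeries (-1) x 3 1 * quadSeries (-1) x 15 5 := by
    linear_combination -quadSeries (-1) x 15 5 * s1 + x ^ 2 * quadSeries (-1) x 3 5 * s2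
  linear_combination h + x ^ 4 * quadSeries (-1) x 15 15 * z + t

/-! ### The two theta identities as Euler products, at q and at -q. -/

/-- `ψ(q)² - q ψ(q⁵)²` as a product. -/
theorem psi_sq_sub_eq {q : ℂ} (h0 : q ≠ 0) (hq : ‖q‖ < 1) :
    eulerProd (q ^ 2) ^ 4 / eulerProd q ^ 2 - q * (eulerProd (q ^ 10) ^ 4 / eulerProd (q ^ 5) ^ 2) =
      eulerProd (q ^ 5) ^ 3 * eulerProd (q ^ 2) / (eulerProd q * eulerProd (q ^ 10)) := by
  -- With q = x², the exponents n(n + 1)/2 of q become n² + n in x.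
  obtain ⟨x, rfl⟩ := IsAlgClosed.exists_pow_nat_eq q (n := 2) (by norm_num)
  have hx0 : x ≠ 0 := by rintro rfl; simp at h0
  have hx : ‖x‖ < 1 := by
    rw [norm_pow] at hq
    exact lt_of_pow_lt_pow_left₀ 2 zero_le_one (by simpa using hq)
  have hε : (1 : ℂ) ^ 2 = 1 := one_pow 2
  have h := quadSeries_sq_dissection hx0 hx
  rw [← quadSeries_neg hε 1 1, ← quadSeries_neg hε 5 5, ← quadSeries_neg hε 5 1,
    ← quadSeries_neg hε 5 3] at h
  simp only [← thetaSeries_eq_quadSeries hε hx0] at h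
  norm_num [zpow_ofNat] at h
  have e1 := thetaSeries_one_mul h0 hq
  have e2 := thetaSeries_one_mul (pow_ne_zero 5 h0) (norm_pow_lt_one hq (n := 5) (by norm_num))
  have e3 := thetaSeries_mul_thetaSeries_five h0 hq
  have n1 := eulerProd_ne_zero hq
  have n5 := eulerProd_ne_zero (norm_pow_lt_one hq (n := 5) (by norm_num))
  have n10 := eulerProd_ne_zero (norm_pow_lt_one hq (n := 10) (by norm_num))
  simp only [← pow_mul, Nat.reduceMul] at e1 e2 e3 n1 n5 n10 ⊢
  rw [← eq_div_iff n1] at e1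
  rw [← eq_div_iff n5] at e2
  rw [← eq_div_iff (mul_ne_zero n1 n10)] at e3
  rw [e1, e2, mul_comm (thetaSeries (x ^ 4) (x ^ 6)), e3] at h
  linear_combination h / 4

/-- `ψ(q²) φ(q⁵) - q φ(q) ψ(q¹⁰)` as a product. -/
theorem psi_mul_phi_sub_eq {q : ℂ} (h0 : q ≠ 0) (hq : ‖q‖ < 1) :
    eulerProd (q ^ 4) ^ 2 / eulerProd (q ^ 2) *
        (eulerProd (q ^ 10) ^ 5 / (eulerProd (q ^ 5) * eulerProd (q ^ 20)) ^ 2) -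
      q * (eulerProd (q ^ 2) ^ 5 / (eulerProd q * eulerProd (q ^ 4)) ^ 2 *
        (eulerProd (q ^ 20) ^ 2 / eulerProd (q ^ 10))) = eulerProd q * eulerProd (q ^ 5) := by
  obtain ⟨x, rfl⟩ := IsAlgClosed.exists_pow_nat_eq q (n := 2) (by norm_num)
  have hx0 : x ≠ 0 := by rintro rfl; simp at h0
  have hx : ‖x‖ < 1 := by
    rw [norm_pow] at hq
    exact lt_of_pow_lt_pow_left₀ 2 zero_le_one (by simpa using hq)
  have hε : (1 : ℂ) ^ 2 = 1 := one_pow 2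
  have hε' : (-1 : ℂ) ^ 2 = 1 := by norm_num
  have h := quadSeries_pentagonal_product hx0 hx
  rw [← quadSeries_neg hε 2 2, ← quadSeries_neg hε 10 10, ← quadSeries_neg hε' 3 1,
    ← quadSeries_neg hε' 15 5] at h
  simp only [← thetaSeries_eq_quadSeries hε hx0, ← thetaSeries_eq_quadSeries hε' hx0] at h
  norm_num [zpow_ofNat] at h
  have hq5 := norm_pow_lt_one hq (n := 5) (by norm_num)
  have e1 := thetaSeries_one_mul (pow_ne_zero 2 h0) (norm_pow_lt_one hq (n := 2) (by norm_num))
  have e2 := thetaSeries_one_mul (pow_ne_zero 10 h0) (norm_pow_lt_one hq (n := 10) (by norm_num))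
  have e3 := thetaSeries_self_mul h0 hq
  have e4 := thetaSeries_self_mul (pow_ne_zero 5 h0) hq5
  have e5 := thetaSeries_pentagonal h0 hq
  have e6 := thetaSeries_pentagonal (pow_ne_zero 5 h0) hq5
  have n1 := eulerProd_ne_zero hq
  have n2 := eulerProd_ne_zero (norm_pow_lt_one hq (n := 2) (by norm_num))
  have n4 := eulerProd_ne_zero (norm_pow_lt_one hq (n := 4) (by norm_num))
  have n5 := eulerProd_ne_zero hq5
  have n10 := eulerProd_ne_zero (norm_pow_lt_one hq (n := 10) (by norm_num))
  have n20 := eulerProd_ne_zero (norm_pow_lt_one hq (n := 20) (by norm_num))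
  simp only [← pow_mul, Nat.reduceMul] at e1 e2 e3 e4 e5 e6 n1 n2 n4 n5 n10 n20 ⊢
  rw [← eq_div_iff n2] at e1
  rw [← eq_div_iff n10] at e2
  rw [← eq_div_iff (pow_ne_zero 2 (mul_ne_zero n1 n4))] at e3
  rw [← eq_div_iff (pow_ne_zero 2 (mul_ne_zero n5 n20))] at e4
  rw [e1, e2, e3, e4, e5, e6] at h
  linear_combination h / 2

/-- This is `psi_sq_sub_eq` at -q: only Euler products at odd powers change, and `eulerProd_neg_mul`
rewrites them. -/
theorem psi_neg_sq_add_eq {q : ℂ} (h0 : q ≠ 0) (hq : ‖q‖ < 1) :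
    (eulerProd q * eulerProd (q ^ 4) / eulerProd (q ^ 2)) ^ 2 +
        q * (eulerProd (q ^ 5) * eulerProd (q ^ 20) / eulerProd (q ^ 10)) ^ 2 =
      eulerProd (q ^ 10) ^ 8 * eulerProd q * eulerProd (q ^ 4) /
        (eulerProd (q ^ 5) ^ 3 * eulerProd (q ^ 20) ^ 3 * eulerProd (q ^ 2) ^ 2) := by
  have h := psi_sq_sub_eq (neg_ne_zero.mpr h0) (by rwa [norm_neg])
  have hq5 := norm_pow_lt_one hq (n := 5) (by norm_num)
  have m1 := eulerProd_neg_mul hq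
  have m5 := eulerProd_neg_mul hq5
  have n1 := eulerProd_ne_zero hq
  have n2 := eulerProd_ne_zero (norm_pow_lt_one hq (n := 2) (by norm_num))
  have n4 := eulerProd_ne_zero (norm_pow_lt_one hq (n := 4) (by norm_num))
  have n5 := eulerProd_ne_zero hq5
  have n10 := eulerProd_ne_zero (norm_pow_lt_one hq (n := 10) (by norm_num))
  have n20 := eulerProd_ne_zero (norm_pow_lt_one hq (n := 20) (by norm_num))
  simp only [← pow_mul, Nat.reduceMul] at m5
  rw [← eq_div_iff (mul_ne_zero n1 n4)] at m1
  rw [← eq_div_iff (mul_ne_zero n5 n20)] at m5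
  rw [Even.neg_pow (n := 2) (by decide), Even.neg_pow (n := 10) (by decide),
    Odd.neg_pow (n := 5) (by decide), m1, m5] at h
  generalize eulerProd q = a1 at *
  generalize eulerProd (q ^ 2) = a2 at *
  generalize eulerProd (q ^ 4) = a4 at *
  generalize eulerProd (q ^ 5) = a5 at *
  generalize eulerProd (q ^ 10) = a10 at *
  generalize eulerProd (q ^ 20) = a20 at *
  clear m1 m5
  field_simp at h ⊢
  linear_combination h

theorem psi_mul_phi_neg_add_eq {q : ℂ} (h0 : q ≠ 0) (hq : ‖q‖ < 1) :
    (eulerProd (q ^ 4) * eulerProd (q ^ 5)) ^ 2 + q * (eulerProd q * eulerProd (q ^ 20)) ^ 2 =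
      eulerProd (q ^ 2) ^ 4 * eulerProd (q ^ 10) ^ 4 /
        (eulerProd q * eulerProd (q ^ 4) * eulerProd (q ^ 5) * eulerProd (q ^ 20)) := by
  have h := psi_mul_phi_sub_eq (neg_ne_zero.mpr h0) (by rwa [norm_neg])
  have hq5 := norm_pow_lt_one hq (n := 5) (by norm_num)
  have m1 := eulerProd_neg_mul hq
  have m5 := eulerProd_neg_mul hq5
  have n1 := eulerProd_ne_zero hq
  have n2 := eulerProd_ne_zero (norm_pow_lt_one hq (n := 2) (by norm_num))
  have n4 := eulerProd_ne_zero (norm_pow_lt_one hq (n := 4) (by norm_num))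
  have n5 := eulerProd_ne_zero hq5
  have n10 := eulerProd_ne_zero (norm_pow_lt_one hq (n := 10) (by norm_num))
  have n20 := eulerProd_ne_zero (norm_pow_lt_one hq (n := 20) (by norm_num))
  simp only [← pow_mul, Nat.reduceMul] at m5
  rw [← eq_div_iff (mul_ne_zero n1 n4)] at m1
  rw [← eq_div_iff (mul_ne_zero n5 n20)] at m5
  rw [Even.neg_pow (n := 2) (by decide), Even.neg_pow (n := 4) (by decide),
    Even.neg_pow (n := 10) (by decide), Even.neg_pow (n := 20) (by decide),
    Odd.neg_pow (n := 5) (by decide), m1, m5] at h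
  generalize eulerProd q = a1 at *
  generalize eulerProd (q ^ 2) = a2 at *
  generalize eulerProd (q ^ 4) = a4 at *
  generalize eulerProd (q ^ 5) = a5 at *
  generalize eulerProd (q ^ 10) = a10 at *
  generalize eulerProd (q ^ 20) = a20 at *
  clear m1 m5
  field_simp at h ⊢
  linear_combination h

/-! ### From Euler products to eta quotients. -/

theorem eulerProd_eq_tprod (q : ℂ) : eulerProd q = ∏' n : ℕ, (1 - q ^ (n + 1)) :=
  tprod_congr fun n => by ring

theorem etaScaled_eq (l : ℕ) (τ : UpperHalfPlane) :
    etaScaled l τ = Function.Periodic.qParam 24 τ ^ l *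
      eulerProd ((Function.Periodic.qParam 24 τ ^ 24) ^ l) := by
  rw [etaScaled, ModularForm.eta, eulerProd_eq_tprod]
  congr 1
  · rw [Function.Periodic.qParam, Function.Periodic.qParam, ← Complex.exp_nat_mul]
    congr 1; push_cast; ring
  · refine tprod_congr fun n => ?_
    rw [ModularForm.eta_q, Function.Periodic.qParam, Function.Periodic.qParam,
      ← Complex.exp_nat_mul _ 24, ← Complex.exp_nat_mul _ l]
    congr 3; push_cast; ring

theorem etaScaled_ne_zero {l : ℕ} (hl : 0 < l) (τ : UpperHalfPlane) : etaScaled l τ ≠ 0 := by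
  refine ModularForm.eta_ne_zero ?_
  have : 0 < (l : ℝ) * τ.im := mul_pos (Nat.cast_pos.mpr hl) τ.im_pos
  simpa [UpperHalfPlane.upperHalfPlaneSet] using this

theorem norm_qParam_pow_lt_one (τ : UpperHalfPlane) :
    ‖Function.Periodic.qParam 24 τ ^ 24‖ < 1 := by
  refine norm_pow_lt_one ?_ (by norm_num)
  exact_mod_cast UpperHalfPlane.norm_qParam_lt_one 24 τ

theorem eta_identity_one_five (τ : UpperHalfPlane) :
    (etaScaled 1 τ * etaScaled 4 τ / etaScaled 2 τ) ^ 2 +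
        (etaScaled 5 τ * etaScaled 20 τ / etaScaled 10 τ) ^ 2 =
      etaScaled 10 τ ^ 8 * etaScaled 1 τ * etaScaled 4 τ /
        (etaScaled 5 τ ^ 3 * etaScaled 20 τ ^ 3 * etaScaled 2 τ ^ 2) := by
  have hy : Function.Periodic.qParam 24 (τ : ℂ) ≠ 0 := Function.Periodic.qParam_ne_zero _
  have h := psi_neg_sq_add_eq (pow_ne_zero 24 hy) (norm_qParam_pow_lt_one τ)
  simp only [etaScaled_eq, pow_one]
  have hne : ∀ n ≠ 0, eulerProd ((Function.Periodic.qParam 24 τ ^ 24) ^ n) ≠ 0 := fun n hn =>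
    eulerProd_ne_zero (norm_pow_lt_one (norm_qParam_pow_lt_one τ) hn)
  have n1 := hne 1 (by norm_num)
  rw [pow_one] at n1
  have n2 := hne 2 (by norm_num)
  have n4 := hne 4 (by norm_num)
  have n5 := hne 5 (by norm_num)
  have n10 := hne 10 (by norm_num)
  have n20 := hne 20 (by norm_num)
  generalize Function.Periodic.qParam 24 (τ : ℂ) = y at *
  generalize eulerProd (y ^ 24) = a1 at *
  generalize eulerProd ((y ^ 24) ^ 2) = a2 at *
  generalize eulerProd ((y ^ 24) ^ 4) = a4 at *
  generalize eulerProd ((y ^ 24) ^ 5) = a5 at *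
  generalize eulerProd ((y ^ 24) ^ 10) = a10 at *
  generalize eulerProd ((y ^ 24) ^ 20) = a20 at *
  -- With y = q^(1/24), the prefactors are y^6 and y^30 = y^6 q, which absorbs the explicit q.
  have e1 : (y * a1 * (y ^ 4 * a4) / (y ^ 2 * a2)) ^ 2 = y ^ 6 * (a1 * a4 / a2) ^ 2 := by
    field_simp
  have e2 : (y ^ 5 * a5 * (y ^ 20 * a20) / (y ^ 10 * a10)) ^ 2 =
      y ^ 6 * (y ^ 24 * (a5 * a20 / a10) ^ 2) := by
    field_simp
  rw [e1, e2, ← mul_add, h]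
  field_simp

theorem eta_identity_four_five (τ : UpperHalfPlane) :
    (etaScaled 4 τ * etaScaled 5 τ) ^ 2 + (etaScaled 1 τ * etaScaled 20 τ) ^ 2 =
      etaScaled 2 τ ^ 4 * etaScaled 10 τ ^ 4 /
        (etaScaled 1 τ * etaScaled 4 τ * etaScaled 5 τ * etaScaled 20 τ) := by
  have hy : Function.Periodic.qParam 24 (τ : ℂ) ≠ 0 := Function.Periodic.qParam_ne_zero _
  have h := psi_mul_phi_neg_add_eq (pow_ne_zero 24 hy) (norm_qParam_pow_lt_one τ)
  simp only [etaScaled_eq, pow_one]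
  have hne : ∀ n ≠ 0, eulerProd ((Function.Periodic.qParam 24 τ ^ 24) ^ n) ≠ 0 := fun n hn =>
    eulerProd_ne_zero (norm_pow_lt_one (norm_qParam_pow_lt_one τ) hn)
  have n1 := hne 1 (by norm_num)
  rw [pow_one] at n1
  have n4 := hne 4 (by norm_num)
  have n5 := hne 5 (by norm_num)
  have n20 := hne 20 (by norm_num)
  generalize Function.Periodic.qParam 24 (τ : ℂ) = y at *
  generalize eulerProd (y ^ 24) = a1 at *
  generalize eulerProd ((y ^ 24) ^ 2) = a2 at *
  generalize eulerProd ((y ^ 24) ^ 4) = a4 at *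
  generalize eulerProd ((y ^ 24) ^ 5) = a5 at *
  generalize eulerProd ((y ^ 24) ^ 10) = a10 at *
  generalize eulerProd ((y ^ 24) ^ 20) = a20 at *
  have e1 : (y ^ 4 * a4 * (y ^ 5 * a5)) ^ 2 + (y * a1 * (y ^ 20 * a20)) ^ 2 =
      y ^ 18 * ((a4 * a5) ^ 2 + y ^ 24 * (a1 * a20) ^ 2) := by ring
  rw [e1, h]
  field_simp

/-! ### The inversion τ ↦ -1/(20τ) and the final combination. -/

theorem sqrt_natCast_mul {m : ℕ} (hm : 0 < m) {z : ℂ} (hz : z ≠ 0) :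
    Complex.sqrt (m * z) = (Real.sqrt m : ℂ) * Complex.sqrt z := by
  have hm' : (0 : ℝ) < m := Nat.cast_pos.mpr hm
  have hm0 : (m : ℂ) ≠ 0 := Nat.cast_ne_zero.mpr hm.ne'
  rw [Real.sqrt_eq_rpow, Real.rpow_def_of_pos hm', Complex.sqrt, Complex.sqrt,
    Complex.cpow_def_of_ne_zero (mul_ne_zero hm0 hz), Complex.cpow_def_of_ne_zero hz,
    ← Complex.ofReal_natCast, Complex.log_ofReal_mul hm' hz, Complex.ofReal_exp, ← Complex.exp_add]
  congr 1
  push_cast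
  ring

/-- For σ = -1/(20τ) and lm = 20, lσ = -1/(mτ), so the inversion formula for η swaps η_l and η_m.
The factor `s` is the same for all l and cancels in homogeneous identities. -/
theorem exists_eta_inversion (τ : UpperHalfPlane) :
    ∃ (σ : UpperHalfPlane) (s : ℂ), s ≠ 0 ∧ ∀ l m : ℕ, 0 < l → 0 < m → l * m = 20 →
      etaScaled l σ = (Real.sqrt m : ℂ) * s * etaScaled m τ := by
  have hτ : (τ : ℂ) ≠ 0 := τ.ne_zero
  have him : 0 < ((-1 : ℂ) / (20 * τ)).im := by
    have h := τ.im_inv_neg_coe_pos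
    have e : (-1 : ℂ) / (20 * τ) = ((1 / 20 : ℝ) : ℂ) * (-(τ : ℂ))⁻¹ := by
      push_cast; field_simp
    rw [e, Complex.im_ofReal_mul]
    positivity
  refine ⟨⟨_, him⟩, (Complex.sqrt Complex.I)⁻¹ * Complex.sqrt τ, ?_, fun l m hl hm hlm => ?_⟩
  · simp [Complex.sqrt, hτ]
  · have hmem : (m : ℂ) * τ ∈ UpperHalfPlane.upperHalfPlaneSet := by
      have : 0 < (m : ℝ) * τ.im := mul_pos (Nat.cast_pos.mpr hm) τ.im_pos
      simpa [UpperHalfPlane.upperHalfPlaneSet] using this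
    have h := ModularForm.eta_comp_eq_csqrt_I_inv hmem
    simp only [Function.comp, Pi.smul_apply, Pi.mul_apply, smul_eq_mul, sqrt_natCast_mul hm hτ] at h
    have hm0 : (m : ℂ) ≠ 0 := Nat.cast_ne_zero.mpr hm.ne'
    have e : (l : ℂ) * (-1 / (20 * τ)) = -1 / (m * τ) := by
      have : (l : ℂ) * m = 20 := by exact_mod_cast hlm
      rw [← this]
      have hl0 : (l : ℂ) ≠ 0 := Nat.cast_ne_zero.mpr hl.ne'
      field_simp
    rw [etaScaled, etaScaled]
    change ModularForm.eta (l * (-1 / (20 * τ))) = _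
    rw [e, h]
    ring

theorem eta_identity_one_five_dual (τ : UpperHalfPlane) :
    (etaScaled 1 τ * etaScaled 4 τ / etaScaled 2 τ) ^ 2 +
        5 * (etaScaled 5 τ * etaScaled 20 τ / etaScaled 10 τ) ^ 2 =
      etaScaled 2 τ ^ 8 * etaScaled 20 τ * etaScaled 5 τ /
        (etaScaled 4 τ ^ 3 * etaScaled 1 τ ^ 3 * etaScaled 10 τ ^ 2) := by
  obtain ⟨σ, s, hs, hσ⟩ := exists_eta_inversion τ
  have h := eta_identity_one_five σ
  rw [hσ 1 20, hσ 2 10, hσ 4 5, hσ 5 4, hσ 10 2, hσ 20 1] at h <;> try norm_num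
  have n1 := etaScaled_ne_zero (l := 1) (by norm_num) τ
  have n2 := etaScaled_ne_zero (l := 2) (by norm_num) τ
  have n4 := etaScaled_ne_zero (l := 4) (by norm_num) τ
  have n5 := etaScaled_ne_zero (l := 5) (by norm_num) τ
  have n10 := etaScaled_ne_zero (l := 10) (by norm_num) τ
  have n20 := etaScaled_ne_zero (l := 20) (by norm_num) τ
  generalize etaScaled 1 τ = a1 at *
  generalize etaScaled 2 τ = a2 at *
  generalize etaScaled 4 τ = a4 at *
  generalize etaScaled 5 τ = a5 at *
  generalize etaScaled 10 τ = a10 at *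
  generalize etaScaled 20 τ = a20 at *
  have q4 : ((Real.sqrt (4 : ℕ) : ℝ) : ℂ) = 2 := by
    rw [show ((4 : ℕ) : ℝ) = 2 ^ 2 by norm_num, Real.sqrt_sq (by norm_num)]; norm_num
  have q20 : ((Real.sqrt (20 : ℕ) : ℝ) : ℂ) = 2 * (Real.sqrt (5 : ℕ) : ℝ) := by
    rw [show ((20 : ℕ) : ℝ) = 2 ^ 2 * (5 : ℕ) by norm_num, Real.sqrt_mul (by norm_num),
      Real.sqrt_sq (by norm_num)]; push_cast; rfl
  have q1 : ((Real.sqrt (1 : ℕ) : ℝ) : ℂ) = 1 := by simp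
  have hsq : ∀ m : ℕ, ((Real.sqrt m : ℝ) : ℂ) ^ 2 = m := fun m => by
    rw [← Complex.ofReal_pow, Real.sq_sqrt (Nat.cast_nonneg m)]; simp
  have q2 := hsq 2
  have q5 := hsq 5
  have q10 := hsq 10
  rw [q4, q20, q1] at h
  generalize ((Real.sqrt (2 : ℕ) : ℝ) : ℂ) = r2 at *
  generalize ((Real.sqrt (5 : ℕ) : ℝ) : ℂ) = r5 at *
  generalize ((Real.sqrt (10 : ℕ) : ℝ) : ℂ) = r10 at *
  have nr2 : r2 ≠ 0 := by rintro rfl; norm_num at q2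
  have nr5 : r5 ≠ 0 := by rintro rfl; norm_num at q5
  have nr10 : r10 ≠ 0 := by rintro rfl; norm_num at q10
  -- The constants are (√20 √5 / √10)² = 10 here and (√4 √1 / √2)² = 2 in `f2`; dividing by 2s²
  -- leaves the coefficient 5.
  have f1 : (2 * r5 * s * a20 * (r5 * s * a5) / (r10 * s * a10)) ^ 2 =
      2 * s ^ 2 * (5 * (a5 * a20 / a10) ^ 2) := by
    field_simp
    linear_combination (2 * r5 ^ 2 + 10) * q5 - 5 * q10
  have f2 : (2 * s * a4 * (1 * s * a1) / (r2 * s * a2)) ^ 2 =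
      2 * s ^ 2 * (a1 * a4 / a2) ^ 2 := by
    field_simp
    linear_combination -q2
  have f3 : (r2 * s * a2) ^ 8 * (2 * r5 * s * a20) * (r5 * s * a5) /
        ((2 * s * a4) ^ 3 * (1 * s * a1) ^ 3 * (r10 * s * a10) ^ 2) =
      2 * s ^ 2 * (a2 ^ 8 * a20 * a5 / (a4 ^ 3 * a1 ^ 3 * a10 ^ 2)) := by
    have e : (r2 * s * a2) ^ 8 * (2 * r5 * s * a20) * (r5 * s * a5) =
        2 * (r2 ^ 2) ^ 4 * r5 ^ 2 * s ^ 10 * (a2 ^ 8 * a20 * a5) := by ring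
    have e' : (2 * s * a4) ^ 3 * (1 * s * a1) ^ 3 * (r10 * s * a10) ^ 2 =
        8 * r10 ^ 2 * s ^ 8 * (a4 ^ 3 * a1 ^ 3 * a10 ^ 2) := by ring
    rw [e, e', q2, q5, q10]
    field_simp
    norm_num
  rw [f1, f2, f3, ← mul_add] at h
  have h' := mul_left_cancel₀ (mul_ne_zero two_ne_zero (pow_ne_zero 2 hs)) h
  rw [add_comm, h']

theorem mainTheorem8 (τ : UpperHalfPlane) :
    1 / uQuot τ + uQuot τ = 1 / vQuot τ + 4 + 5 * vQuot τ := by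
  have hA := eta_identity_one_five τ
  have hB := eta_identity_one_five_dual τ
  have hC := eta_identity_four_five τ
  rw [uQuot, vQuot]
  have n1 := etaScaled_ne_zero (l := 1) (by norm_num) τ
  have n2 := etaScaled_ne_zero (l := 2) (by norm_num) τ
  have n4 := etaScaled_ne_zero (l := 4) (by norm_num) τ
  have n5 := etaScaled_ne_zero (l := 5) (by norm_num) τ
  have n10 := etaScaled_ne_zero (l := 10) (by norm_num) τ
  have n20 := etaScaled_ne_zero (l := 20) (by norm_num) τ
  generalize etaScaled 1 τ = a1 at *
  generalize etaScaled 2 τ = a2 at *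
  generalize etaScaled 4 τ = a4 at *
  generalize etaScaled 5 τ = a5 at *
  generalize etaScaled 10 τ = a10 at *
  generalize etaScaled 20 τ = a20 at *
  have hu : 1 / (a1 * a20 / (a4 * a5)) ^ 2 + (a1 * a20 / (a4 * a5)) ^ 2 + 2 =
      (((a4 * a5) ^ 2 + (a1 * a20) ^ 2) / (a1 * a20 * (a4 * a5))) ^ 2 := by
    field_simp
    ring
  have hv : 1 / (a2 * a5 * a20 / (a1 * a4 * a10)) ^ 2 + 4 +
      5 * (a2 * a5 * a20 / (a1 * a4 * a10)) ^ 2 + 2 =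
      ((a1 * a4 / a2) ^ 2 + (a5 * a20 / a10) ^ 2) *
        ((a1 * a4 / a2) ^ 2 + 5 * (a5 * a20 / a10) ^ 2) /
          ((a1 * a4 / a2) ^ 2 * (a5 * a20 / a10) ^ 2) := by
    field_simp
    ring
  apply add_right_cancel (b := 2)
  rw [hu, hv, hA, hB, hC]
  field_simp
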